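/- Let $(V,\eta)$ be four-dimensional Minkowski space: a real vector space with a symmetric bilinear form $\eta$ of signature $(1,3)$ (one minus sign, three plus signs). Fix $s_0\in V$ with $\eta(s_0,s_0)=-1$ and let $\mathcal S=\{v\in V:\eta(v,v)=-1,\ \eta(v,s_0)\le -1\}$ be the corresponding connected component of the hyperboloid of unit timelike vectors, with tangent spaces $T_s\mathcal S=\{u\in V:\eta(u,s)=0\}$ and the Riemannian metric $h=\eta|_{T\mathcal S}$. By a boost in the plane $P\subset V$ we mean a proper orthochronous Lorentz transformation of $(V,\eta)$ that fixes the $\eta$-orthogonal complement of $P$ pointwise. Let $s_1\neq s_2$ be points of $\mathcal S$ and let $\sigma_1<\sigma_2$ be real numbers. Then there is a unique boost $B(s_1,s_2)$ in the plane $\mathrm{Span}\{s_1,s_2\}$ that maps $s_1$ to $s_2$, and there is a unique geodesic $\gamma:[\sigma_1,\sigma_2]\to\mathcal S$ of the Levi-Civita connection of $h$ with $\gamma(\sigma_1)=s_1$ and $\gamma(\sigma_2)=s_2$. For every $Y_1\in T_{s_1}\mathcal S$, Levi-Civita parallel transport of $Y_1$ along $\gamma$ from $s_1$ to $s_2$ is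 well defined and results in $Y_2=B(s_1,s_2)\,Y_1\in T_{s_2}\mathcal S$. -/

import Mathlib

open Set Filter
open scoped Topology ContDiff

noncomputable section

/-! ### Minkowski space, its state space and the Lorentz group -/

section Minkowski

variable {V : Type*} [AddCommGroup V] [Module ℝ V]

/-- `η` is a Lorentzian inner product of signature `(n₋, n₊) = (1, 3)` ("mostly plus") on the
real vector space `V`: it has an orthonormal basis `b 0, b 1, b 2, b 3` with
`η (b 0) (b 0) = -1` and `η (b i) (b i) = 1` for `i = 1, 2, 3`. In particular `V` has dimension
four and `η` is symmetric and nondegenerate. -/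
def IsLorentzian (η : LinearMap.BilinForm ℝ V) : Prop :=
  ∃ b : Module.Basis (Fin 4) ℝ V,
    ∀ i j, η (b i) (b j) = if i = j then (if i = 0 then -1 else 1) else 0

/-- The state space `𝒮`: the connected component of the hyperboloid of unit timelike vectors
that contains the unit timelike vector `s₀`. -/
def stateSpace (η : LinearMap.BilinForm ℝ V) (s₀ : V) : Set V :=
  {v | η v v = -1 ∧ η v s₀ ≤ -1}

/-- The tangent space `T_s 𝒮`, i.e. the `η`-orthogonal complement of `s` in `V`. -/
def stateTangent (η : LinearMap.BilinForm ℝ V) (s : V) : Set V :=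
  {u | η u s = 0}

/-- `L` belongs to the proper orthochronous Lorentz group of `(V, η)`. -/
def IsProperOrthochronous (η : LinearMap.BilinForm ℝ V) (L : V →ₗ[ℝ] V) : Prop :=
  (∀ u v, η (L u) (L v) = η u v) ∧ LinearMap.det L = 1 ∧ ∀ v, η v v < 0 → η (L v) v < 0

/-- `L` is a boost in the plane `P`: a proper orthochronous Lorentz transformation that fixes
the `η`-orthogonal complement of `P` pointwise. -/
def IsBoostInPlane (η : LinearMap.BilinForm ℝ V) (P : Submodule ℝ V) (L : V →ₗ[ℝ] V) : Prop :=
  IsProperOrthochronous η L ∧ ∀ u, (∀ p ∈ P, η u p = 0) → L u = u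

end Minkowski

/-! ### The Levi-Civita connection of a metric in coordinates -/

/-- The partial derivative `∂f/∂xⁱ` of a real function at the point `x` of coordinate space. -/
def partialDeriv {n : ℕ} (i : Fin n) (f : (Fin n → ℝ) → ℝ) (x : Fin n → ℝ) : ℝ :=
  fderiv ℝ f x (Pi.single i 1)

/-- The Christoffel symbols
`Γᵏᵢⱼ = ½ ∑ₗ gᵏˡ (∂ᵢ gⱼₗ + ∂ⱼ gᵢₗ - ∂ₗ gᵢⱼ)` of the metric with components `gᵢⱼ`, i.e. the
coefficients of its Levi-Civita connection. -/
def christoffel {n : ℕ} (g : (Fin n → ℝ) → Matrix (Fin n) (Fin n) ℝ) (x : Fin n → ℝ)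
    (k i j : Fin n) : ℝ :=
  (1 / 2 : ℝ) * ∑ l, (g x)⁻¹ k l *
    (partialDeriv i (fun z => g z j l) x + partialDeriv j (fun z => g z i l) x
      - partialDeriv l (fun z => g z i j) x)

/-- The components `y'ᵏ + ∑ᵢⱼ Γᵏᵢⱼ(x) x'ⁱ yʲ` of the Levi-Civita covariant derivative of a vector
field along a curve, at a parameter value where the curve has position `x` and velocity `x'` and
the field has components `y` with derivative `y'`. -/
def covDerivCoord {n : ℕ} (g : (Fin n → ℝ) → Matrix (Fin n) (Fin n) ℝ)
    (x x' y y' : Fin n → ℝ) : Fin n → ℝ :=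
  fun k => y' k + ∑ i, ∑ j, christoffel g x k i j * x' i * y j

/-! ### Geodesics and parallel transport on the state space

The norm on `V` serves only to speak about derivatives; since `V` is finite-dimensional, nothing
depends on its choice. -/

section Transport

variable {V : Type*} [NormedAddCommGroup V] [NormedSpace ℝ V]

/-- `Φ` is a smooth local parametrization (inverse of a chart) of the 3-dimensional manifold
`𝒮 = stateSpace η s₀`, defined on the open subset `U` of coordinate space. -/
structure IsLocalParam (η : LinearMap.BilinForm ℝ V) (s₀ : V) (U : Set (Fin 3 → ℝ))
    (Φ : (Fin 3 → ℝ) → V) : Prop where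
  isOpen : IsOpen U
  smooth : ContDiffOn ℝ ∞ Φ U
  mapsTo : MapsTo Φ U (stateSpace η s₀)
  injOn : InjOn Φ U
  immersive : ∀ x ∈ U, Function.Injective (fderiv ℝ Φ x)

/-- The components `hᵢⱼ = η(∂ᵢΦ, ∂ⱼΦ)`, with respect to the parametrization `Φ`, of the metric
`h = η|_{T𝒮}` induced on `𝒮`. -/
def inducedMetric (η : LinearMap.BilinForm ℝ V) (Φ : (Fin 3 → ℝ) → V) (x : Fin 3 → ℝ) :
    Matrix (Fin 3) (Fin 3) ℝ :=
  Matrix.of fun i j => η (fderiv ℝ Φ x (Pi.single i 1)) (fderiv ℝ Φ x (Pi.single j 1))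

/-- `Z` is the covariant derivative at the parameter `t ∈ I`, for the Levi-Civita connection of
the induced metric on `𝒮`, of the field `Y` of tangent vectors along the curve `γ : I → 𝒮`:
in a local parametrization `Φ` around `γ t`, in which `γ = Φ ∘ x` and `Y = ∑ᵢ yⁱ ∂ᵢΦ(x)`,
it is given by the Christoffel symbols. -/
def HasCovDerivAlong (η : LinearMap.BilinForm ℝ V) (s₀ : V) (I : Set ℝ) (γ Y : ℝ → V) (t : ℝ)
    (Z : V) : Prop :=
  ∃ (U : Set (Fin 3 → ℝ)) (Φ : (Fin 3 → ℝ) → V) (x y : ℝ → Fin 3 → ℝ) (x' y' : Fin 3 → ℝ),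
    IsLocalParam η s₀ U Φ ∧
    (∀ᶠ τ in 𝓝[I] t, x τ ∈ U ∧ γ τ = Φ (x τ) ∧ Y τ = fderiv ℝ Φ (x τ) (y τ)) ∧
    HasDerivWithinAt x x' I t ∧ HasDerivWithinAt y y' I t ∧
    Z = fderiv ℝ Φ (x t) (covDerivCoord (inducedMetric η Φ) (x t) x' (y t) y')

/-- `γ` restricts to a smooth curve `[a, b] → 𝒮`. -/
def IsSmoothCurve (η : LinearMap.BilinForm ℝ V) (s₀ : V) (a b : ℝ) (γ : ℝ → V) : Prop :=
  ContDiffOn ℝ ∞ γ (Icc a b) ∧ ∀ t ∈ Icc a b, γ t ∈ stateSpace η s₀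

/-- `Y` is a smooth field of tangent vectors of `𝒮` along `γ : [a, b] → 𝒮` that is parallel for
the Levi-Civita connection. -/
def IsParallelAlong (η : LinearMap.BilinForm ℝ V) (s₀ : V) (a b : ℝ) (γ Y : ℝ → V) : Prop :=
  ContDiffOn ℝ ∞ Y (Icc a b) ∧ ∀ t ∈ Icc a b,
    Y t ∈ stateTangent η (γ t) ∧ HasCovDerivAlong η s₀ (Icc a b) γ Y t 0

/-- `γ : [a, b] → 𝒮` is a geodesic for the Levi-Civita connection: its velocity field is
parallel along it. -/
def IsGeodesic (η : LinearMap.BilinForm ℝ V) (s₀ : V) (a b : ℝ) (γ : ℝ → V) : Prop :=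
  IsSmoothCurve η s₀ a b γ ∧ IsParallelAlong η s₀ a b γ (derivWithin γ (Icc a b))

/-- Parallel transport along `γ : [a, b] → 𝒮` takes `Y₁ ∈ T_{γ(a)} 𝒮` to `Y₂ ∈ T_{γ(b)} 𝒮`. -/
def IsParallelTransport (η : LinearMap.BilinForm ℝ V) (s₀ : V) (a b : ℝ) (γ : ℝ → V)
    (Y₁ Y₂ : V) : Prop :=
  ∃ Y : ℝ → V, IsParallelAlong η s₀ a b γ Y ∧ Y a = Y₁ ∧ Y b = Y₂

end Transport

end

/-! Everything is pulled back to the ambient space `V`. By the Gauss formula (`apply_covDerivCoord`)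
the Levi-Civita derivative is the tangential part of the ordinary derivative, so a tangent field is
parallel iff its derivative is a multiple of `γ` (`isParallelAlong_iff`). Geodesics therefore solve
`γ'' = κ γ` with constant `κ = η γ' γ'`; distinct endpoints force `κ > 0`, and `γ` is an arc `cosh •
s + sinh • e` (`geodesic_eq_hyperbola`), fixed by its endpoints (`hyperbola_unique`). Along such an
arc the component of `y` along `e` follows the unit velocity while the rest of `y` stays constant
(`hyperbolaTransport`). Parallel fields are unique because the norm of a difference is constant and
the metric is positive definite on tangent spaces. The boost is the product of the reflections along
`s₁` and `s₁ + s₂`. Undoing it after any other candidate leaves an isometry of determinant one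
covered by `eq_id_of_fixes`, which gives uniqueness. Explicit formulas then identify transport with
boost (`hyperbolaTransport_right`). -/

namespace IsLorentzian

/-! ### Lorentzian linear algebra -/

section Algebra

variable {V : Type*} [AddCommGroup V] [Module ℝ V] {η : LinearMap.BilinForm ℝ V}

/-- An orthonormal frame whose timelike member points in the same direction as `s₀`. -/
structure IsFrame (η : LinearMap.BilinForm ℝ V) (s₀ e₀ : V) (e : Fin 3 → V) : Prop where
  time_time : η e₀ e₀ = -1
  time_space : ∀ i, η e₀ (e i) = 0
  space_time : ∀ i, η (e i) e₀ = 0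
  space_space : ∀ i j, η (e i) (e j) = if i = j then 1 else 0
  expand : ∀ v, v = -η v e₀ • e₀ + ∑ i, η v (e i) • e i
  future : η e₀ s₀ ≤ 0

theorem finiteDimensional (h : IsLorentzian η) : FiniteDimensional ℝ V := by
  obtain ⟨b, -⟩ := h
  exact b.finiteDimensional_of_finite

theorem finrank (h : IsLorentzian η) : Module.finrank ℝ V = 4 := by
  obtain ⟨b, -⟩ := h
  simp [Module.finrank_eq_card_basis b]

theorem exists_frame (h : IsLorentzian η) (s₀ : V) :
    ∃ (e₀ : V) (e : Fin 3 → V), IsFrame η s₀ e₀ e := by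
  obtain ⟨b, hb⟩ := h
  have key : ∀ v, v = -η v (b 0) • b 0 + ∑ i : Fin 3, η v (b i.succ) • b i.succ := by
    intro v
    have h1 : ∀ j, η v (b j) = b.repr v j * (if j = 0 then -1 else 1) := by
      intro j
      conv_lhs => rw [← b.sum_repr v]
      simp only [map_sum, map_smul, LinearMap.sum_apply, LinearMap.smul_apply, smul_eq_mul, hb]
      simp only [mul_ite, mul_zero, Finset.sum_ite_eq', Finset.mem_univ, if_true]
    conv_lhs => rw [← b.sum_repr v, Fin.sum_univ_succ]
    simp [h1, Fin.succ_ne_zero]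
  rcases le_total (η (b 0) s₀) 0 with h0 | h0
  · exact ⟨b 0, fun i => b i.succ, by simp [hb], by simp [hb, (Fin.succ_ne_zero _).symm],
      by simp [hb, Fin.succ_ne_zero], by simp [hb, Fin.succ_ne_zero], key, h0⟩
  · exact ⟨-b 0, fun i => b i.succ, by simp [hb], by simp [hb, (Fin.succ_ne_zero _).symm],
      by simp [hb, Fin.succ_ne_zero], by simp [hb, Fin.succ_ne_zero],
      fun v => by simpa using key v, by simpa using h0⟩

theorem IsFrame.apply {s₀ e₀ : V} {e : Fin 3 → V} (f : IsFrame η s₀ e₀ e) (v w : V) :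
    η v w = -(η v e₀ * η w e₀) + ∑ i, η v (e i) * η w (e i) := by
  conv_lhs => rw [f.expand w]
  simp [map_sum, mul_comm]

theorem symm (h : IsLorentzian η) (v w : V) : η v w = η w v := by
  obtain ⟨e₀, e, f⟩ := h.exists_frame 0
  rw [f.apply v w, f.apply w v, mul_comm]
  simp only [mul_comm]

theorem IsFrame.apply_self {s₀ e₀ : V} {e : Fin 3 → V} (f : IsFrame η s₀ e₀ e) (v : V) :
    η v v = -(η v e₀) ^ 2 + ∑ i, η v (e i) ^ 2 := by
  rw [f.apply v v]
  simp only [sq]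

theorem IsFrame.sum_mul_sq_le {e : Fin 3 → V} (v w : V) :
    (∑ i, η v (e i) * η w (e i)) ^ 2 ≤ (∑ i, η v (e i) ^ 2) * ∑ i, η w (e i) ^ 2 :=
  Finset.sum_mul_sq_le_sq_mul_sq _ _ _

/-- The metric is positive definite on the orthogonal complement of a timelike vector. -/
theorem pos_of_orthogonal (h : IsLorentzian η) {s u : V} (hs : η s s < 0) (hu : η u s = 0)
    (hu0 : u ≠ 0) : 0 < η u u := by
  obtain ⟨e₀, e, f⟩ := h.exists_frame 0
  have h1 := f.apply u s
  have h2 := f.apply_self s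
  have h3 := f.apply_self u
  have h4 := IsFrame.sum_mul_sq_le (η := η) (e := e) u s
  have hn : 0 ≤ ∑ i, η u (e i) ^ 2 := Finset.sum_nonneg fun i _ => sq_nonneg _
  have hm : 0 ≤ ∑ i, η s (e i) ^ 2 := Finset.sum_nonneg fun i _ => sq_nonneg _
  have h5 : (∑ i, η u (e i) * η s (e i)) = η u e₀ * η s e₀ := by linarith
  rw [h5, mul_pow] at h4
  by_contra hneg
  set A := ∑ i, η u (e i) ^ 2
  set C := ∑ i, η s (e i) ^ 2
  -- If `A > 0`, then `A ≤ (η u e₀)²` turns Cauchy-Schwarz into `(η s e₀)² ≤ C`, contradicting that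
  -- `s` is timelike.
  have hA : A = 0 := by
    by_contra hA
    have hA' : 0 < A := lt_of_le_of_ne hn (Ne.symm hA)
    have : A * (η s e₀) ^ 2 ≤ A * C :=
      (mul_le_mul_of_nonneg_right (by linarith) (sq_nonneg _)).trans h4
    have := le_of_mul_le_mul_left this hA'
    linarith
  have hs0 : 0 < (η s e₀) ^ 2 := by linarith
  have hu2 : (η u e₀) ^ 2 = 0 := by
    rw [hA, zero_mul] at h4
    nlinarith [sq_nonneg (η u e₀)]
  have hu3 : η u e₀ = 0 := by simpa using hu2
  have hu4 : ∀ i, η u (e i) = 0 := by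
    intro i
    have := (Finset.sum_eq_zero_iff_of_nonneg (fun i _ => sq_nonneg (η u (e i)))).1 hA i
      (Finset.mem_univ i)
    simpa using this
  apply hu0
  rw [f.expand u]
  simp [hu3, hu4]

theorem nonneg_of_orthogonal (h : IsLorentzian η) {s u : V} (hs : η s s < 0) (hu : η u s = 0) :
    0 ≤ η u u := by
  by_cases hu0 : u = 0
  · simp [hu0]
  · exact (h.pos_of_orthogonal hs hu hu0).le

theorem eq_zero_of_orthogonal (h : IsLorentzian η) {s u : V} (hs : η s s < 0) (hu : η u s = 0)
    (huu : η u u = 0) : u = 0 := by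
  by_contra hu0
  exact (h.pos_of_orthogonal hs hu hu0).ne' huu

/-- By Cauchy-Schwarz the spatial part of `η v w` is smaller in absolute value than the product of
the time components, so the latter decides the sign. -/
theorem IsFrame.timelike_mul_neg {s₀ e₀ : V} {e : Fin 3 → V} (f : IsFrame η s₀ e₀ e) {v w : V}
    (hv : η v v < 0) (hw : η w w < 0) : η v w * (η v e₀ * η w e₀) < 0 := by
  have h1 := f.apply v w
  have h2 := f.apply_self v
  have h3 := f.apply_self w
  have h4 := IsFrame.sum_mul_sq_le (η := η) (e := e) v w
  set X := ∑ i, η v (e i) * η w (e i)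
  have hn : 0 ≤ ∑ i, η v (e i) ^ 2 := Finset.sum_nonneg fun i _ => sq_nonneg _
  have hm : 0 ≤ ∑ i, η w (e i) ^ 2 := Finset.sum_nonneg fun i _ => sq_nonneg _
  have h5 : X ^ 2 < (η v e₀ * η w e₀) ^ 2 := by
    rw [mul_pow]
    exact h4.trans_lt (mul_lt_mul'' (by linarith) (by linarith) hn hm)
  rw [h1]
  set p := η v e₀ * η w e₀
  nlinarith [sq_nonneg (X - p)]

/-- The product of the three inner products of timelike vectors is negative. -/
theorem timelike_mul_neg (h : IsLorentzian η) {u v w : V} (hu : η u u < 0)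
    (hv : η v v < 0) (hw : η w w < 0) : η u v * η v w * η u w < 0 := by
  obtain ⟨e₀, e, f⟩ := h.exists_frame 0
  have h1 := f.timelike_mul_neg hu hv
  have h2 := f.timelike_mul_neg hv hw
  have h3 := f.timelike_mul_neg hu hw
  have h4 := mul_pos_of_neg_of_neg h1 h2
  have h5 := mul_neg_of_pos_of_neg h4 h3
  have h6 : η u v * (η u e₀ * η v e₀) * (η v w * (η v e₀ * η w e₀)) * (η u w * (η u e₀ * η w e₀))
    = η u v * η v w * η u w * (η u e₀ * η v e₀ * η w e₀) ^ 2 := by ring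
  rw [h6] at h5
  by_contra hc
  exact absurd h5 (not_lt.2 (mul_nonneg (not_lt.1 hc) (sq_nonneg _)))

/-- The reversed Cauchy-Schwarz inequality for unit timelike vectors. -/
theorem one_le_sq (h : IsLorentzian η) {u v : V} (hu : η u u = -1) (hv : η v v = -1) :
    1 ≤ η u v ^ 2 := by
  have := h.nonneg_of_orthogonal (s := v) (u := u + η u v • v) (by rw [hv]; norm_num)
    (by simp [hv])
  simp [hu, hv, h.symm v u] at this
  nlinarith

theorem mem_stateSpace_iff (h : IsLorentzian η) {s₀ v : V} (hs₀ : η s₀ s₀ = -1)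
    (hv : η v v = -1) : v ∈ stateSpace η s₀ ↔ η v s₀ < 0 := by
  constructor
  · rintro ⟨-, h2⟩
    linarith
  · intro h2
    refine ⟨hv, ?_⟩
    nlinarith [h.one_le_sq hv hs₀]

theorem inner_lt_neg_one (h : IsLorentzian η) {s₀ s₁ s₂ : V} (hs₀ : η s₀ s₀ = -1)
    (hs₁ : s₁ ∈ stateSpace η s₀) (hs₂ : s₂ ∈ stateSpace η s₀) (hne : s₁ ≠ s₂) :
    η s₁ s₂ < -1 := by
  have h1 : η s₁ s₂ < 0 := by
    have := h.timelike_mul_neg (u := s₁) (v := s₀) (w := s₂) (by rw [hs₁.1]; norm_num)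
      (by rw [hs₀]; norm_num) (by rw [hs₂.1]; norm_num)
    have h2 := hs₁.2
    have h3 := hs₂.2
    rw [h.symm] at h3
    have : 0 < η s₁ s₀ * η s₀ s₂ := by nlinarith
    by_contra hc
    nlinarith
  -- The vector is the part of `s₁` orthogonal to `s₂`; it is nonzero since `s₁ ≠ s₂`, which makes
  -- reversed Cauchy-Schwarz strict.
  have h2 := h.pos_of_orthogonal (s := s₂) (u := s₁ + η s₁ s₂ • s₂) (by rw [hs₂.1]; norm_num)
    (by simp [hs₂.1]) ?_
  · simp [hs₁.1, hs₂.1, h.symm s₂ s₁] at h2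
    nlinarith
  · intro h0
    have h3 := congrArg (η s₁) h0
    simp [hs₁.1] at h3
    have h4 : η s₁ s₂ = -1 := by nlinarith
    rw [h4] at h0
    apply hne
    simpa [← sub_eq_add_neg, sub_eq_zero] using h0

/-! ### Reflections and boosts -/

/-- The reflection in the hyperplane `η`-orthogonal to `n`. -/
noncomputable def reflect (η : LinearMap.BilinForm ℝ V) (n : V) : V →ₗ[ℝ] V :=
  LinearMap.transvection (-(2 / η n n) • η.flip n) n

theorem reflect_apply (n v : V) : reflect η n v = v - (2 * η v n / η n n) • n := by
  simp only [reflect, LinearMap.transvection.apply, LinearMap.smul_apply, LinearMap.BilinForm.flip_apply]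
  rw [sub_eq_add_neg, ← neg_smul]
  congr 2
  simp
  ring

theorem det_reflect [FiniteDimensional ℝ V] {n : V} (hn : η n n ≠ 0) :
    LinearMap.det (reflect η n) = -1 := by
  -- A transvection `v ↦ v + f v • n` has determinant `1 + f n`, here `1 - 2`.
  rw [reflect, LinearMap.transvection.det]
  simp
  field_simp
  norm_num

theorem reflect_isometry (h : IsLorentzian η) {n : V} (hn : η n n ≠ 0) (u v : V) :
    η (reflect η n u) (reflect η n v) = η u v := by
  simp only [reflect_apply, map_sub, map_smul, LinearMap.sub_apply, LinearMap.smul_apply,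
    smul_eq_mul, h.symm n v]
  field_simp
  ring

/-- The boost taking `s₁` to `s₂`, as a product of two reflections. -/
noncomputable def boost (η : LinearMap.BilinForm ℝ V) (s₁ s₂ : V) : V →ₗ[ℝ] V :=
  reflect η (s₁ + s₂) ∘ₗ reflect η s₁

theorem add_self_ne (h : IsLorentzian η) {s₁ s₂ : V} (hs₁ : η s₁ s₁ = -1) (hs₂ : η s₂ s₂ = -1)
    (h12 : η s₁ s₂ < 0) : η (s₁ + s₂) (s₁ + s₂) = 2 * (η s₁ s₂ - 1) ∧
      η (s₁ + s₂) (s₁ + s₂) ≠ 0 := by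
  have : η (s₁ + s₂) (s₁ + s₂) = 2 * (η s₁ s₂ - 1) := by
    simp [hs₁, hs₂, h.symm s₂ s₁]
    ring
  refine ⟨this, ?_⟩
  rw [this]
  nlinarith

/-- The first reflection negates `s₁`. The second swaps `-s₁` and `s₂`, because `s₁ - s₂` is
orthogonal to `s₁ + s₂`. -/
theorem boost_left (h : IsLorentzian η) {s₁ s₂ : V} (hs₁ : η s₁ s₁ = -1) (hs₂ : η s₂ s₂ = -1)
    (h12 : η s₁ s₂ < 0) : boost η s₁ s₂ s₁ = s₂ := by
  obtain ⟨h1, h2⟩ := h.add_self_ne hs₁ hs₂ h12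
  have h3 : reflect η s₁ s₁ = -s₁ := by
    rw [reflect_apply, hs₁]
    norm_num
    module
  have h4 : 2 * η s₁ (s₁ + s₂) / η (s₁ + s₂) (s₁ + s₂) = 1 := by
    rw [div_eq_one_iff_eq h2, h1]
    simp [hs₁]
    ring
  simp only [boost, LinearMap.comp_apply, h3, map_neg]
  rw [reflect_apply, h4]
  module

theorem boost_isometry (h : IsLorentzian η) {s₁ s₂ : V} (hs₁ : η s₁ s₁ = -1) (hs₂ : η s₂ s₂ = -1)
    (h12 : η s₁ s₂ < 0) (u v : V) : η (boost η s₁ s₂ u) (boost η s₁ s₂ v) = η u v := by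
  rw [boost, LinearMap.comp_apply, LinearMap.comp_apply,
    h.reflect_isometry (h.add_self_ne hs₁ hs₂ h12).2,
    h.reflect_isometry (by rw [hs₁]; norm_num)]

theorem isBoostInPlane_boost (h : IsLorentzian η) {s₁ s₂ : V} (hs₁ : η s₁ s₁ = -1)
    (hs₂ : η s₂ s₂ = -1) (h12 : η s₁ s₂ < 0) :
    IsBoostInPlane η (Submodule.span ℝ {s₁, s₂}) (boost η s₁ s₂) := by
  have := h.finiteDimensional
  obtain ⟨h1, h2⟩ := h.add_self_ne hs₁ hs₂ h12
  refine ⟨⟨h.boost_isometry hs₁ hs₂ h12, ?_, ?_⟩, ?_⟩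
  · rw [boost, LinearMap.det_comp, det_reflect h2, det_reflect (by rw [hs₁]; norm_num)]
    norm_num
  · intro v hv
    have h3 : η (boost η s₁ s₂ v) s₂ = η v s₁ := by
      rw [← h.boost_isometry hs₁ hs₂ h12 v s₁, h.boost_left hs₁ hs₂ h12]
    have hs₁' : η s₁ s₁ < 0 := by rw [hs₁]; norm_num
    have hs₂' : η s₂ s₂ < 0 := by rw [hs₂]; norm_num
    have hB : η (boost η s₁ s₂ v) (boost η s₁ s₂ v) < 0 := by
      rwa [h.boost_isometry hs₁ hs₂ h12]
    -- The triples `(Bv, v, s₂)` and `(v, s₁, s₂)` share the factor `η v s₁ * η v s₂`: the second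
    -- shows that it is positive, and the first then gives the sign of `η (Bv) v`.
    have h4 := h.timelike_mul_neg hB hv hs₂'
    have h5 := h.timelike_mul_neg hv hs₁' hs₂'
    rw [h3] at h4
    by_contra hc
    have h6 : 0 ≤ η v s₁ * η v s₂ := by nlinarith
    have h7 := mul_nonneg (not_lt.1 hc) h6
    nlinarith
  · intro u hu
    have hu1 : η u s₁ = 0 := hu s₁ (Submodule.subset_span (by simp))
    have hu2 : η u s₂ = 0 := hu s₂ (Submodule.subset_span (by simp))
    simp [boost, reflect_apply, hu1, hu2]

/-- An isometry of determinant one that fixes a timelike vector `s`, and all vectors orthogonal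
to `s` and to another vector `t`, is trivial. -/
theorem eq_id_of_fixes (h : IsLorentzian η) {s t : V} (hs : η s s = -1)
    {L : V →ₗ[ℝ] V} (hL : ∀ u v, η (L u) (L v) = η u v) (hdet : LinearMap.det L = 1)
    (hLs : L s = s) (hLp : ∀ u, η u s = 0 → η u t = 0 → L u = u)
    (het : η (t + η t s • s) (t + η t s • s) ≠ 0) : L = LinearMap.id := by
  have := h.finiteDimensional
  set e := t + η t s • s with he
  have hes : η e s = 0 := by simp [he, hs]
  -- The displacement `d` is orthogonal to `s` and to every fixed vector `p`. Its part `r` off `e`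
  -- is itself such a `p`, so `η r r = 0` and `r` vanishes by definiteness.
  have hLe : ∀ v, L v = v + (η (L v - v) e / η e e) • e := by
    intro v
    set d := L v - v with hd
    have hds : η d s = 0 := by
      have := hL v s
      rw [hLs] at this
      simp [hd, this]
    have hdp : ∀ p, η p s = 0 → η p t = 0 → η d p = 0 := by
      intro p h1 h2
      have := hL v p
      rw [hLp p h1 h2] at this
      simp [hd, this]
    set r := d - (η d e / η e e) • e with hr
    have hrs : η r s = 0 := by simp [hr, hds, hes]
    have hre : η r e = 0 := by
      simp only [hr, map_sub, map_smul, LinearMap.sub_apply, LinearMap.smul_apply, smul_eq_mul]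
      field_simp
      ring
    have hrt : η r t = 0 := by
      have : t = e - η t s • s := by simp [he]
      rw [this]
      simp [hrs, hre]
    have hrd := hdp r hrs hrt
    have hrr : η r r = 0 := by
      conv_lhs => rw [hr]
      simp only [map_sub, map_smul, LinearMap.sub_apply, LinearMap.smul_apply, smul_eq_mul]
      trans η d r - η d e / η e e * η r e
      · rw [h.symm r e]
        simp only [hr, map_sub, map_smul, smul_eq_mul]
        ring
      · rw [hrd, hre]
        simp
    have := h.eq_zero_of_orthogonal (by rw [hs]; norm_num) hrs hrr
    rw [hr, sub_eq_zero] at this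
    rw [← this, hd]
    abel
  -- As a transvection along `e`, `L` has determinant one only if it fixes `e`.
  have hform : L = LinearMap.transvection
      ((η e e)⁻¹ • (η.flip e ∘ₗ (L - LinearMap.id))) e := by
    ext v
    rw [LinearMap.transvection.apply]
    simp only [LinearMap.smul_apply, LinearMap.comp_apply, LinearMap.sub_apply,
      LinearMap.id_apply, LinearMap.BilinForm.flip_apply, smul_eq_mul]
    conv_lhs => rw [hLe v, div_eq_inv_mul]
  rw [hform, LinearMap.transvection.det] at hdet
  have hk : η (L e - e) e = 0 := by
    simp only [LinearMap.smul_apply, LinearMap.comp_apply, LinearMap.sub_apply,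
      LinearMap.id_apply, LinearMap.BilinForm.flip_apply, smul_eq_mul] at hdet
    have : (η e e)⁻¹ * η (L e - e) e = 0 := by linarith
    simpa [het] using this
  have hee : L e = e := by
    rw [hLe e, hk]
    simp
  ext v
  set p := v + η v s • s - (η v e / η e e) • e with hp
  have hse : η s e = 0 := by rw [h.symm, hes]
  have hps : η p s = 0 := by simp [hp, hes, hs]
  have hpe : η p e = 0 := by
    simp only [hp, map_sub, map_add, map_smul, LinearMap.sub_apply, LinearMap.add_apply,
      LinearMap.smul_apply, smul_eq_mul, hse]
    field_simp
    ring
  have hpt : η p t = 0 := by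
    have : t = e - η t s • s := by simp [he]
    rw [this]
    simp [hps, hpe]
  have hv : v = p - η v s • s + (η v e / η e e) • e := by
    rw [hp]
    abel
  rw [LinearMap.id_apply]
  conv_lhs => rw [hv]
  simp only [map_add, map_sub, map_smul, hLp p hps hpt, hLs, hee]
  exact hv.symm

theorem eq_boost (h : IsLorentzian η) {s₁ s₂ : V} (hs₁ : η s₁ s₁ = -1)
    (hs₂ : η s₂ s₂ = -1) (h12 : η s₁ s₂ < -1) {B : V →ₗ[ℝ] V}
    (hB : IsBoostInPlane η (Submodule.span ℝ {s₁, s₂}) B) (hB12 : B s₁ = s₂) :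
    B = boost η s₁ s₂ := by
  have h12' : η s₁ s₂ < 0 := by linarith
  have hn₁ : η s₁ s₁ ≠ 0 := by rw [hs₁]; norm_num
  obtain ⟨-, hn⟩ := h.add_self_ne hs₁ hs₂ h12'
  have := h.finiteDimensional
  have refl_refl : ∀ {n : V}, η n n ≠ 0 → ∀ v, reflect η n (reflect η n v) = v := by
    intro n hn v
    have hnn : reflect η n n = -n := by
      rw [reflect_apply, mul_div_assoc, div_self hn]
      module
    conv_lhs => rw [reflect_apply n v, map_sub, map_smul, hnn, reflect_apply]
    module
  have inv_left : ∀ v, reflect η s₁ (reflect η (s₁ + s₂) (boost η s₁ s₂ v)) = v := by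
    intro v
    rw [boost, LinearMap.comp_apply, refl_refl hn, refl_refl hn₁]
  have inv_right : ∀ v, boost η s₁ s₂ (reflect η s₁ (reflect η (s₁ + s₂) v)) = v := by
    intro v
    rw [boost, LinearMap.comp_apply, refl_refl hn₁, refl_refl hn]
  have key : reflect η s₁ ∘ₗ reflect η (s₁ + s₂) ∘ₗ B = LinearMap.id := by
    refine h.eq_id_of_fixes (s := s₁) (t := s₂) hs₁ ?_ ?_ ?_ ?_ ?_
    · intro u v
      simp only [LinearMap.comp_apply]
      rw [h.reflect_isometry hn₁, h.reflect_isometry hn, hB.1.1]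
    · rw [LinearMap.det_comp, LinearMap.det_comp, det_reflect hn, det_reflect hn₁, hB.1.2.1]
      norm_num
    · simp only [LinearMap.comp_apply, hB12]
      conv_rhs => rw [← inv_left s₁, h.boost_left hs₁ hs₂ h12']
    · intro u h1 h2
      have : B u = u := by
        refine hB.2 u fun p hp => ?_
        obtain ⟨a, b, rfl⟩ := Submodule.mem_span_pair.1 hp
        simp [h1, h2]
      simp [this, reflect_apply, h1, h2]
    · simp [hs₁, hs₂, h.symm s₂ s₁]
      nlinarith
  ext v
  rw [← inv_right (B v)]
  exact congrArg _ (LinearMap.congr_fun key v)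

theorem boost_apply_tangent (h : IsLorentzian η) {s₁ s₂ : V} (hs₁ : η s₁ s₁ = -1)
    (hs₂ : η s₂ s₂ = -1) (h12 : η s₁ s₂ < 0) {v : V} (hv : η v s₁ = 0) :
    boost η s₁ s₂ v = v - (η v s₂ / (η s₁ s₂ - 1)) • (s₁ + s₂) := by
  rw [boost, LinearMap.comp_apply, reflect_apply s₁, hv]
  simp only [mul_zero, zero_div, zero_smul, sub_zero]
  rw [reflect_apply, (h.add_self_ne hs₁ hs₂ h12).1, mul_div_mul_left _ _ two_ne_zero]
  simp [hv]

end Algebra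

end IsLorentzian

namespace IsLorentzian

/-! ### The Gauss formula in local parametrizations -/

section Gauss

variable {V : Type*} [NormedAddCommGroup V] [NormedSpace ℝ V] {η : LinearMap.BilinForm ℝ V}

theorem hasDerivWithinAt_apply (h : IsLorentzian η) {f g : ℝ → V} {f' g' : V} {I : Set ℝ} {t : ℝ}
    (hf : HasDerivWithinAt f f' I t) (hg : HasDerivWithinAt g g' I t) :
    HasDerivWithinAt (fun τ => η (f τ) (g τ)) (η (f t) g' + η f' (g t)) I t := by
  have := h.finiteDimensional
  exact (LinearMap.toContinuousBilinearMap η).hasDerivWithinAt_of_bilinear hf hg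

theorem hasFDerivAt_apply (h : IsLorentzian η) {E : Type*} [NormedAddCommGroup E]
    [NormedSpace ℝ E] {f g : E → V} {f' g' : E →L[ℝ] V} {x : E}
    (hf : HasFDerivAt f f' x) (hg : HasFDerivAt g g' x) (w : E) :
    fderiv ℝ (fun z => η (f z) (g z)) x w = η (f x) (g' w) + η (f' w) (g x) := by
  have := h.finiteDimensional
  have hd : HasFDerivAt (fun z => η (f z) (g z)) _ x :=
    (LinearMap.toContinuousBilinearMap η).hasFDerivAt_of_bilinear hf hg
  rw [hd.fderiv]
  simp

variable {s₀ : V} {U : Set (Fin 3 → ℝ)} {Φ : (Fin 3 → ℝ) → V} {x : Fin 3 → ℝ}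

theorem _root_.IsLocalParam.contDiffAt (hΦ : IsLocalParam η s₀ U Φ) (hx : x ∈ U) :
    ContDiffAt ℝ ∞ Φ x :=
  hΦ.smooth.contDiffAt (hΦ.isOpen.mem_nhds hx)

theorem _root_.IsLocalParam.hasFDerivAt (hΦ : IsLocalParam η s₀ U Φ) (hx : x ∈ U) :
    HasFDerivAt Φ (fderiv ℝ Φ x) x :=
  ((hΦ.contDiffAt hx).differentiableAt (by simp)).hasFDerivAt

theorem _root_.IsLocalParam.hasFDerivAt_fderiv (hΦ : IsLocalParam η s₀ U Φ) (hx : x ∈ U) :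
    HasFDerivAt (fderiv ℝ Φ) (fderiv ℝ (fderiv ℝ Φ) x) x :=
  (((hΦ.contDiffAt hx).fderiv_right (m := ∞) le_rfl).differentiableAt (by simp)).hasFDerivAt

theorem _root_.IsLocalParam.symm (hΦ : IsLocalParam η s₀ U Φ) (hx : x ∈ U) (v w : Fin 3 → ℝ) :
    fderiv ℝ (fderiv ℝ Φ) x v w = fderiv ℝ (fderiv ℝ Φ) x w v :=
  (hΦ.contDiffAt hx).isSymmSndFDerivAt (by
    simp only [minSmoothness_of_isRCLikeNormedField]; exact WithTop.coe_le_coe.2 (le_top : (2 : ℕ∞) ≤ ⊤)) v w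

theorem fderiv_tangent (h : IsLorentzian η) (hΦ : IsLocalParam η s₀ U Φ) (hx : x ∈ U)
    (w : Fin 3 → ℝ) : η (fderiv ℝ Φ x w) (Φ x) = 0 := by
  have h1 := h.hasFDerivAt_apply (hΦ.hasFDerivAt hx) (hΦ.hasFDerivAt hx) w
  have h2 : (fun z => η (Φ z) (Φ z)) =ᶠ[𝓝 x] fun _ => (-1 : ℝ) := by
    filter_upwards [hΦ.isOpen.mem_nhds hx] with z hz using (hΦ.mapsTo hz).1
  rw [h2.fderiv_eq, h.symm (Φ x)] at h1
  simp at h1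
  linarith

/-- Dimension count: the image of the injective differential is three-dimensional and lies in a
proper subspace of a four-dimensional space. -/
theorem exists_fderiv_eq (h : IsLorentzian η) (hΦ : IsLocalParam η s₀ U Φ) (hx : x ∈ U)
    {u : V} (hu : η u (Φ x) = 0) : ∃ w, fderiv ℝ Φ x w = u := by
  have := h.finiteDimensional
  have hΦx := (hΦ.mapsTo hx).1
  let T : Submodule ℝ V := LinearMap.ker (η.flip (Φ x))
  have hle : LinearMap.range (fderiv ℝ Φ x : (Fin 3 → ℝ) →ₗ[ℝ] V) ≤ T := by
    rintro _ ⟨w, rfl⟩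
    exact h.fderiv_tangent hΦ hx w
  have h3 : Module.finrank ℝ (LinearMap.range (fderiv ℝ Φ x : (Fin 3 → ℝ) →ₗ[ℝ] V)) = 3 := by
    rw [LinearMap.finrank_range_of_inj (hΦ.immersive x hx)]
    simp
  have hT : Module.finrank ℝ T ≤ 3 := by
    have hlt : T < ⊤ := by
      refine lt_top_iff_ne_top.2 fun htop => ?_
      have : Φ x ∈ T := htop ▸ Submodule.mem_top
      have h0 : η (Φ x) (Φ x) = 0 := this
      rw [hΦx] at h0
      norm_num at h0
    have := Submodule.finrank_lt hlt.ne
    rw [h.finrank] at this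
    omega
  have heq := Submodule.eq_of_le_of_finrank_le hle (by rw [h3]; exact hT)
  have : u ∈ T := hu
  rw [← heq] at this
  exact this

theorem partialDeriv_inducedMetric (h : IsLorentzian η) (hΦ : IsLocalParam η s₀ U Φ)
    (hx : x ∈ U) (k i j : Fin 3) :
    partialDeriv k (fun z => inducedMetric η Φ z i j) x =
      η (fderiv ℝ Φ x (Pi.single i 1))
          (fderiv ℝ (fderiv ℝ Φ) x (Pi.single k 1) (Pi.single j 1)) +
        η (fderiv ℝ (fderiv ℝ Φ) x (Pi.single k 1) (Pi.single i 1))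
          (fderiv ℝ Φ x (Pi.single j 1)) := by
  have hd : ∀ w : Fin 3 → ℝ, HasFDerivAt (fun z => fderiv ℝ Φ z w)
      ((fderiv ℝ (fderiv ℝ Φ) x).flip w) x := by
    intro w
    have := (hΦ.hasFDerivAt_fderiv hx).clm_apply (hasFDerivAt_const w x)
    simpa using this
  have := h.hasFDerivAt_apply (hd (Pi.single i 1)) (hd (Pi.single j 1)) (Pi.single k 1)
  simpa [partialDeriv, inducedMetric] using this

theorem fderiv_eq_sum (w : Fin 3 → ℝ) :
    fderiv ℝ Φ x w = ∑ i, w i • fderiv ℝ Φ x (Pi.single i 1) := by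
  conv_lhs => rw [pi_eq_sum_univ' w]
  simp

theorem inducedMetric_mulVec (h : IsLorentzian η) (w : Fin 3 → ℝ) (i : Fin 3) :
    (inducedMetric η Φ x).mulVec w i = η (fderiv ℝ Φ x w) (fderiv ℝ Φ x (Pi.single i 1)) := by
  rw [h.symm, fderiv_eq_sum w]
  simp [Matrix.mulVec, dotProduct, inducedMetric, mul_comm]

/-- A kernel vector would give a tangent vector of norm zero, which vanishes by positive
definiteness, against immersivity. -/
theorem isUnit_det_inducedMetric (h : IsLorentzian η) (hΦ : IsLocalParam η s₀ U Φ)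
    (hx : x ∈ U) : IsUnit (inducedMetric η Φ x).det := by
  rw [isUnit_iff_ne_zero]
  intro h0
  obtain ⟨w, hw, hw0⟩ := Matrix.exists_mulVec_eq_zero_iff.2 h0
  have h1 : ∀ i, η (fderiv ℝ Φ x w) (fderiv ℝ Φ x (Pi.single i 1)) = 0 := fun i => by
    rw [← h.inducedMetric_mulVec, hw0]
    rfl
  have h2 : η (fderiv ℝ Φ x w) (fderiv ℝ Φ x w) = 0 := by
    conv_lhs => rw [fderiv_eq_sum (x := x) (Φ := Φ) w, map_sum]
    refine Finset.sum_eq_zero fun i _ => ?_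
    rw [← fderiv_eq_sum, map_smul, h1, smul_zero]
  have h3 := h.eq_zero_of_orthogonal (by rw [(hΦ.mapsTo hx).1]; norm_num)
    (h.fderiv_tangent hΦ hx w) h2
  exact hw (hΦ.immersive x hx (by rw [h3, map_zero]))

/-- The Christoffel symbols of the first kind of an induced metric are the tangential components
of the second derivatives of the parametrization. -/
theorem inducedMetric_mulVec_christoffel (h : IsLorentzian η) (hΦ : IsLocalParam η s₀ U Φ)
    (hx : x ∈ U) (i j l : Fin 3) :
    (inducedMetric η Φ x).mulVec (fun k => christoffel (inducedMetric η Φ) x k i j) l =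
      η (fderiv ℝ (fderiv ℝ Φ) x (Pi.single i 1) (Pi.single j 1))
        (fderiv ℝ Φ x (Pi.single l 1)) := by
  set T : Fin 3 → ℝ := fun l => partialDeriv i (fun z => inducedMetric η Φ z j l) x +
    partialDeriv j (fun z => inducedMetric η Φ z i l) x -
    partialDeriv l (fun z => inducedMetric η Φ z i j) x with hT
  have h1 : (fun k => christoffel (inducedMetric η Φ) x k i j) =
      (1 / 2 : ℝ) • (inducedMetric η Φ x)⁻¹.mulVec T := by
    ext k
    simp [christoffel, Matrix.mulVec, dotProduct, hT]
  rw [h1, Matrix.mulVec_smul, Matrix.mulVec_mulVec,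
    Matrix.mul_nonsing_inv _ (h.isUnit_det_inducedMetric hΦ hx), Matrix.one_mulVec]
  simp only [Pi.smul_apply, hT, h.partialDeriv_inducedMetric hΦ hx, smul_eq_mul]
  -- Symmetry of second derivatives cancels four of the six product-rule terms; the other two
  -- coincide and absorb the factor `1 / 2`.
  rw [hΦ.symm hx (Pi.single l 1) (Pi.single i 1), hΦ.symm hx (Pi.single l 1) (Pi.single j 1),
    hΦ.symm hx (Pi.single j 1) (Pi.single i 1),
    h.symm (fderiv ℝ Φ x (Pi.single j 1)), h.symm (fderiv ℝ Φ x (Pi.single i 1))]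
  ring

/-- The Gauss formula: the Levi-Civita covariant derivative is the tangential component of the
derivative in the ambient space. -/
theorem apply_covDerivCoord (h : IsLorentzian η) (hΦ : IsLocalParam η s₀ U Φ)
    (hx : x ∈ U) (x' y y' w : Fin 3 → ℝ) :
    η (fderiv ℝ Φ x (covDerivCoord (inducedMetric η Φ) x x' y y')) (fderiv ℝ Φ x w) =
      η (fderiv ℝ (fderiv ℝ Φ) x x' y + fderiv ℝ Φ x y') (fderiv ℝ Φ x w) := by
  have key : ∀ l, η (fderiv ℝ Φ x (covDerivCoord (inducedMetric η Φ) x x' y y'))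
      (fderiv ℝ Φ x (Pi.single l 1)) =
      η (fderiv ℝ (fderiv ℝ Φ) x x' y + fderiv ℝ Φ x y') (fderiv ℝ Φ x (Pi.single l 1)) := by
    intro l
    have h1 : covDerivCoord (inducedMetric η Φ) x x' y y' =
        y' + ∑ i, ∑ j, (x' i * y j) • fun k => christoffel (inducedMetric η Φ) x k i j := by
      ext k
      simp only [covDerivCoord, Pi.add_apply, Finset.sum_apply, Pi.smul_apply, smul_eq_mul]
      congr 1
      refine Finset.sum_congr rfl fun i _ => Finset.sum_congr rfl fun j _ => by ring
    have h2 : fderiv ℝ (fderiv ℝ Φ) x x' y = ∑ i, ∑ j, (x' i * y j) •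
        fderiv ℝ (fderiv ℝ Φ) x (Pi.single i 1) (Pi.single j 1) := by
      conv_lhs => rw [pi_eq_sum_univ' x', pi_eq_sum_univ' y]
      simp only [map_sum, map_smul, _root_.sum_apply,
        _root_.smul_apply, Finset.smul_sum, smul_smul]
      rw [Finset.sum_comm]
      refine Finset.sum_congr rfl fun i _ => Finset.sum_congr rfl fun j _ => ?_
      rw [mul_comm]
    rw [h1, ← h.inducedMetric_mulVec, Matrix.mulVec_add, Pi.add_apply, h.inducedMetric_mulVec, h2,
      map_add, LinearMap.add_apply, add_comm]
    congr 1
    rw [← Matrix.mulVecLin_apply]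
    simp only [map_sum, map_smul, Finset.sum_apply, Pi.smul_apply, LinearMap.sum_apply,
      LinearMap.smul_apply, Matrix.mulVecLin_apply, h.inducedMetric_mulVec_christoffel hΦ hx]
  rw [fderiv_eq_sum (x := x) (Φ := Φ) w]
  simp only [map_sum, map_smul, key]

/-- Derivative of a field along a curve given in a local parametrization. -/
theorem hasDerivWithinAt_field {I : Set ℝ} {t : ℝ} {Y : ℝ → V}
    {c y : ℝ → Fin 3 → ℝ} {c' y' : Fin 3 → ℝ} (hΦ : IsLocalParam η s₀ U Φ)
    (ht : t ∈ I) (hU : c t ∈ U) (hY : ∀ᶠ τ in 𝓝[I] t, Y τ = fderiv ℝ Φ (c τ) (y τ))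
    (hc : HasDerivWithinAt c c' I t) (hy : HasDerivWithinAt y y' I t) :
    HasDerivWithinAt Y (fderiv ℝ (fderiv ℝ Φ) (c t) c' (y t) + fderiv ℝ Φ (c t) y') I t := by
  have h1 := (hΦ.hasFDerivAt_fderiv hU).comp_hasDerivWithinAt t hc
  exact (h1.clm_apply hy).congr_of_eventuallyEq hY (hY.self_of_nhdsWithin ht)

/-- The tangential part `d + η d s • s` may itself be used as a test vector, so it is null and hence
zero. -/
theorem exists_smul_of_tangent_eq_zero (h : IsLorentzian η) {s d : V} (hs : η s s = -1)
    (hd : ∀ u, η u s = 0 → η d u = 0) : ∃ k : ℝ, d = k • s := by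
  refine ⟨-η d s, ?_⟩
  have h1 : η (d + η d s • s) s = 0 := by simp [hs]
  have h2 := hd _ h1
  have h3 := h.eq_zero_of_orthogonal (by rw [hs]; norm_num) h1 (by
    rw [LinearMap.map_add₂, LinearMap.map_smul₂, h2, h.symm s, h1]
    simp)
  rw [neg_smul]
  exact eq_neg_of_add_eq_zero_left h3

theorem exists_hasDerivWithinAt_of_hasCovDerivAlong (h : IsLorentzian η) {I : Set ℝ}
    {γ Y : ℝ → V} {t : ℝ} (ht : t ∈ I) (hcov : HasCovDerivAlong η s₀ I γ Y t 0) :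
    ∃ k : ℝ, HasDerivWithinAt Y (k • γ t) I t := by
  obtain ⟨U, Φ, c, y, c', y', hΦ, hev, hc, hy, hZ⟩ := hcov
  obtain ⟨hU, hγ, -⟩ := hev.self_of_nhdsWithin ht
  have hD := hasDerivWithinAt_field hΦ ht hU (hev.mono fun τ hτ => hτ.2.2) hc hy
  obtain ⟨k, hk⟩ := h.exists_smul_of_tangent_eq_zero (s := γ t)
    (d := fderiv ℝ (fderiv ℝ Φ) (c t) c' (y t) + fderiv ℝ Φ (c t) y')
    (by rw [hγ]; exact (hΦ.mapsTo hU).1) (by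
      intro u hu
      rw [hγ] at hu
      obtain ⟨w, rfl⟩ := h.exists_fderiv_eq hΦ hU hu
      rw [← h.apply_covDerivCoord hΦ hU, ← hZ]
      simp)
  exact ⟨k, hk ▸ hD⟩

/-! ### A global graph chart, and parallelism in ambient terms -/

theorem IsFrame.apply_time_neg (h : IsLorentzian η) {e₀ : V} {e : Fin 3 → V}
    (f : IsFrame η s₀ e₀ e) (hs₀ : η s₀ s₀ = -1) {v : V} (hv : v ∈ stateSpace η s₀) :
    η v e₀ < 0 := by
  have h1 := h.timelike_mul_neg (u := v) (v := s₀) (w := e₀) (by rw [hv.1]; norm_num)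
    (by rw [hs₀]; norm_num) (by rw [f.time_time]; norm_num)
  have h2 := hv.2
  have h3 := f.future
  rw [h.symm] at h3
  have h4 : 0 ≤ η v s₀ * η s₀ e₀ := by nlinarith
  by_contra hc
  nlinarith

/-- The parametrization of the state space by the spatial components. -/
noncomputable def graphParam (e₀ : V) (e : Fin 3 → V) (z : Fin 3 → ℝ) : V :=
  √(1 + ∑ i, z i ^ 2) • e₀ + ∑ i, z i • e i

theorem IsFrame.graphParam_space {e₀ : V} {e : Fin 3 → V} (f : IsFrame η s₀ e₀ e)
    (z : Fin 3 → ℝ) (j : Fin 3) : η (graphParam e₀ e z) (e j) = z j := by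
  simp [graphParam, f.time_space, f.space_space]

theorem IsFrame.graphParam_time {e₀ : V} {e : Fin 3 → V} (f : IsFrame η s₀ e₀ e)
    (z : Fin 3 → ℝ) : η (graphParam e₀ e z) e₀ = -√(1 + ∑ i, z i ^ 2) := by
  simp [graphParam, f.time_time, f.space_time]

theorem contDiff_graphParam (e₀ : V) (e : Fin 3 → V) : ContDiff ℝ ∞ (graphParam e₀ e) := by
  have hpos : ∀ z : Fin 3 → ℝ, 1 + ∑ i, z i ^ 2 ≠ 0 := fun z => by positivity
  unfold graphParam
  refine ContDiff.add (ContDiff.smul (ContDiff.sqrt (by fun_prop) hpos) contDiff_const) ?_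
  fun_prop

theorem IsFrame.fderiv_graphParam_space (h : IsLorentzian η) {e₀ : V} {e : Fin 3 → V}
    (f : IsFrame η s₀ e₀ e) (z w : Fin 3 → ℝ) (j : Fin 3) :
    η (fderiv ℝ (graphParam e₀ e) z w) (e j) = w j := by
  have h1 := h.hasFDerivAt_apply
    ((contDiff_graphParam e₀ e).differentiable (by simp) z).hasFDerivAt
    (hasFDerivAt_const (e j) z) w
  have h2 : (fun z => η (graphParam e₀ e z) (e j)) =
      (ContinuousLinearMap.proj j : (Fin 3 → ℝ) →L[ℝ] ℝ) := by
    ext z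
    simp [f.graphParam_space]
  rw [h2, ContinuousLinearMap.fderiv] at h1
  simpa using h1.symm

/-- Pairing with the `e j` recovers the coordinates, and their differentials, which gives
injectivity and immersivity at once. -/
theorem IsFrame.isLocalParam_graphParam (h : IsLorentzian η) {e₀ : V} {e : Fin 3 → V}
    (f : IsFrame η s₀ e₀ e) (hs₀ : η s₀ s₀ = -1) :
    IsLocalParam η s₀ univ (graphParam e₀ e) where
  isOpen := isOpen_univ
  smooth := (contDiff_graphParam e₀ e).contDiffOn
  mapsTo := by
    intro z _
    have hpos : 0 < 1 + ∑ i, z i ^ 2 := by positivity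
    have hself : η (graphParam e₀ e z) (graphParam e₀ e z) = -1 := by
      rw [f.apply_self, f.graphParam_time]
      simp only [f.graphParam_space]
      rw [neg_sq, Real.sq_sqrt hpos.le]
      ring
    rw [h.mem_stateSpace_iff hs₀ hself]
    have h1 := f.timelike_mul_neg (v := graphParam e₀ e z) (w := s₀) (by rw [hself]; norm_num)
      (by rw [hs₀]; norm_num)
    rw [f.graphParam_time, h.symm s₀] at h1
    have h2 := Real.sqrt_pos.2 hpos
    have h3 := f.future
    by_contra hc
    have h4 : 0 ≤ -√(1 + ∑ i, z i ^ 2) * η e₀ s₀ := by nlinarith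
    have h5 := mul_nonneg (not_lt.1 hc) h4
    linarith
  injOn := by
    intro z _ w _ hzw
    ext j
    rw [← f.graphParam_space z j, ← f.graphParam_space w j, hzw]
  immersive := by
    intro z _ v w hvw
    ext j
    rw [← f.fderiv_graphParam_space h z v j, hvw, f.fderiv_graphParam_space h]

theorem IsFrame.eq_graphParam (h : IsLorentzian η) {e₀ : V} {e : Fin 3 → V}
    (f : IsFrame η s₀ e₀ e) (hs₀ : η s₀ s₀ = -1) {v : V} (hv : v ∈ stateSpace η s₀) :
    v = graphParam e₀ e fun i => η v (e i) := by
  have h1 := f.apply_self v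
  rw [hv.1] at h1
  have h2 := f.apply_time_neg h hs₀ hv
  have h3 : √(1 + ∑ i, η v (e i) ^ 2) = -η v e₀ := by
    rw [show 1 + ∑ i, η v (e i) ^ 2 = (-η v e₀) ^ 2 by rw [neg_sq]; linarith]
    exact Real.sqrt_sq (by linarith)
  conv_lhs => rw [f.expand v]
  rw [graphParam, h3]

/-- The two sides are tangent at `v` and share their spatial components. Orthogonality of the
difference to `v` then kills its time component, as `η v e₀ ≠ 0`. -/
theorem IsFrame.eq_fderiv_graphParam (h : IsLorentzian η) {e₀ : V} {e : Fin 3 → V}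
    (f : IsFrame η s₀ e₀ e) (hs₀ : η s₀ s₀ = -1) {v u : V} (hv : v ∈ stateSpace η s₀)
    (hu : η u v = 0) :
    u = fderiv ℝ (graphParam e₀ e) (fun i => η v (e i)) fun i => η u (e i) := by
  set w := fderiv ℝ (graphParam e₀ e) (fun i => η v (e i)) fun i => η u (e i) with hw
  have hwv : η w v = 0 := by
    have := h.fderiv_tangent (f.isLocalParam_graphParam h hs₀)
      (mem_univ fun i => η v (e i)) fun i => η u (e i)
    rwa [← f.eq_graphParam h hs₀ hv] at this
  have hspace : ∀ i, η (u - w) (e i) = 0 := fun i => by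
    rw [map_sub, LinearMap.sub_apply, hw, f.fderiv_graphParam_space h, sub_self]
  have horth : η (u - w) v = 0 := by simp [hu, hwv]
  rw [f.apply] at horth
  simp only [hspace] at horth
  have htime : η (u - w) e₀ = 0 := by
    have := (f.apply_time_neg h hs₀ hv).ne
    simpa [this] using horth
  rw [← sub_eq_zero, f.expand (u - w)]
  simp only [htime, hspace]
  simp

theorem hasCovDerivAlong_zero (h : IsLorentzian η) (hs₀ : η s₀ s₀ = -1) {I : Set ℝ}
    {γ Y : ℝ → V} {t k : ℝ} {γ' : V} (ht : t ∈ I) (hγ : ∀ τ ∈ I, γ τ ∈ stateSpace η s₀)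
    (hγ' : HasDerivWithinAt γ γ' I t) (hY : ∀ τ ∈ I, η (Y τ) (γ τ) = 0)
    (hY' : HasDerivWithinAt Y (k • γ t) I t) (huniq : UniqueDiffWithinAt ℝ I t) :
    HasCovDerivAlong η s₀ I γ Y t 0 := by
  obtain ⟨e₀, e, f⟩ := h.exists_frame s₀
  have hΦ := f.isLocalParam_graphParam h hs₀
  have hcoord : ∀ {X : ℝ → V} {X' : V}, HasDerivWithinAt X X' I t →
      HasDerivWithinAt (fun τ i => η (X τ) (e i)) (fun i => η X' (e i)) I t := by
    intro X X' hX
    refine hasDerivWithinAt_pi.2 fun i => ?_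
    simpa using h.hasDerivWithinAt_apply hX (hasDerivWithinAt_const t I (e i))
  have hev : ∀ τ ∈ I, (fun i => η (γ τ) (e i)) ∈ univ ∧
      γ τ = graphParam e₀ e (fun i => η (γ τ) (e i)) ∧
      Y τ = fderiv ℝ (graphParam e₀ e) (fun i => η (γ τ) (e i)) fun i => η (Y τ) (e i) :=
    fun τ hτ => ⟨mem_univ _, f.eq_graphParam h hs₀ (hγ τ hτ),
      f.eq_fderiv_graphParam h hs₀ (hγ τ hτ) (hY τ hτ)⟩
  have hev' := eventually_nhdsWithin_of_forall (a := t) hev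
  refine ⟨univ, graphParam e₀ e, fun τ i => η (γ τ) (e i), fun τ i => η (Y τ) (e i),
    _, _, hΦ, hev', hcoord hγ', hcoord hY', ?_⟩
  have hD := hasDerivWithinAt_field hΦ ht (mem_univ _) (hev'.mono fun τ hτ => hτ.2.2)
    (hcoord hγ') (hcoord hY')
  have hD' := huniq.eq_deriv _ hD hY'
  -- The covariant derivative is tangent, and by the Gauss formula its norm equals its pairing with
  -- the normal vector `k • γ t`, which is zero.
  refine (h.eq_zero_of_orthogonal (s := γ t) (by rw [(hγ t ht).1]; norm_num) ?_ ?_).symm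
  · conv_lhs => arg 2; rw [(hev t ht).2.1]
    exact h.fderiv_tangent hΦ (mem_univ _) _
  · rw [h.apply_covDerivCoord hΦ (mem_univ _), hD', map_smul, LinearMap.smul_apply, h.symm]
    conv_lhs => arg 2; arg 2; rw [(hev t ht).2.1]
    rw [h.fderiv_tangent hΦ (mem_univ _), smul_zero]

/-- A field is parallel along a curve of the state space iff it is tangent and its derivative in
the ambient space is normal. -/
theorem isParallelAlong_iff (h : IsLorentzian η) (hs₀ : η s₀ s₀ = -1) {a b : ℝ} (hab : a < b)
    {γ Y : ℝ → V} (hγ : IsSmoothCurve η s₀ a b γ) :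
    IsParallelAlong η s₀ a b γ Y ↔ ContDiffOn ℝ ∞ Y (Icc a b) ∧ ∀ t ∈ Icc a b,
      η (Y t) (γ t) = 0 ∧ ∃ k : ℝ, HasDerivWithinAt Y (k • γ t) (Icc a b) t := by
  refine and_congr_right fun hY => ⟨fun H t ht => ⟨(H t ht).1, ?_⟩, fun H t ht => ⟨(H t ht).1, ?_⟩⟩
  · exact h.exists_hasDerivWithinAt_of_hasCovDerivAlong ht (H t ht).2
  · obtain ⟨-, k, hk⟩ := H t ht
    exact h.hasCovDerivAlong_zero hs₀ ht hγ.2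
      ((hγ.1.differentiableOn (by simp) t ht).hasDerivWithinAt)
      (fun τ hτ => (H τ hτ).1) hk (uniqueDiffOn_Icc hab t ht)

end Gauss

end IsLorentzian

namespace IsLorentzian

/-! ### Geodesics as hyperbolas and parallel transport along them -/

section Geodesics

variable {V : Type*} [NormedAddCommGroup V] [NormedSpace ℝ V] {η : LinearMap.BilinForm ℝ V}
  {s₀ : V} {a b : ℝ}

theorem eq_left_of_hasDerivWithinAt_zero {E : Type*} [NormedAddCommGroup E] [NormedSpace ℝ E]
    (hab : a < b) {f : ℝ → E} (hf : ∀ t ∈ Icc a b, HasDerivWithinAt f 0 (Icc a b) t) :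
    ∀ t ∈ Icc a b, f t = f a :=
  constant_of_derivWithin_zero (fun t ht => (hf t ht).differentiableWithinAt) fun t ht =>
    (hf t (Ico_subset_Icc_self ht)).derivWithin (uniqueDiffOn_Icc hab t (Ico_subset_Icc_self ht))

/-- Parallel fields along a curve are determined by their initial value. -/
theorem parallel_unique (h : IsLorentzian η) (hs₀ : η s₀ s₀ = -1) (hab : a < b) {γ Y W : ℝ → V}
    (hγ : IsSmoothCurve η s₀ a b γ) (hY : IsParallelAlong η s₀ a b γ Y)
    (hW : IsParallelAlong η s₀ a b γ W) (h0 : Y a = W a) : ∀ t ∈ Icc a b, Y t = W t := by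
  rw [h.isParallelAlong_iff hs₀ hab hγ] at hY hW
  have horth : ∀ t ∈ Icc a b, η (Y t - W t) (γ t) = 0 := fun t ht => by
    rw [map_sub, LinearMap.sub_apply, (hY.2 t ht).1, (hW.2 t ht).1, sub_zero]
  have hconst := eq_left_of_hasDerivWithinAt_zero hab
    (f := fun t => η (Y t - W t) (Y t - W t)) fun t ht => by
      obtain ⟨-, k, hk⟩ := hY.2 t ht
      obtain ⟨-, l, hl⟩ := hW.2 t ht
      have hd : HasDerivWithinAt (fun τ => Y τ - W τ) (k • γ t - l • γ t) (Icc a b) t := hk.sub hl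
      refine (h.hasDerivWithinAt_apply hd hd).congr_deriv ?_
      rw [← sub_smul, map_smul, map_smul, LinearMap.smul_apply, h.symm (γ t), horth t ht]
      simp
  intro t ht
  have := hconst t ht
  simp only [h0, sub_self, map_zero] at this
  exact sub_eq_zero.1 (h.eq_zero_of_orthogonal (by rw [(hγ.2 t ht).1]; norm_num) (horth t ht) this)

/-- The geodesic equation in the ambient space. -/
theorem geodesic_equation (h : IsLorentzian η) (hs₀ : η s₀ s₀ = -1) (hab : a < b) {γ : ℝ → V}
    (hγ : IsGeodesic η s₀ a b γ) :
    ∃ (κ : ℝ) (γ' : ℝ → V), ∀ t ∈ Icc a b, η (γ' t) (γ t) = 0 ∧ η (γ' t) (γ' t) = κ ∧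
      HasDerivWithinAt γ (γ' t) (Icc a b) t ∧ HasDerivWithinAt γ' (κ • γ t) (Icc a b) t := by
  obtain ⟨hs, hp⟩ := hγ
  rw [h.isParallelAlong_iff hs₀ hab hs] at hp
  set γ' := derivWithin γ (Icc a b)
  have hd : ∀ t ∈ Icc a b, HasDerivWithinAt γ (γ' t) (Icc a b) t := fun t ht =>
    (hs.1.differentiableOn (by simp) t ht).hasDerivWithinAt
  have hconst := eq_left_of_hasDerivWithinAt_zero hab
    (f := fun t => η (γ' t) (γ' t)) fun t ht => by
      obtain ⟨h1, k, hk⟩ := hp.2 t ht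
      refine (h.hasDerivWithinAt_apply hk hk).congr_deriv ?_
      rw [map_smul, map_smul, LinearMap.smul_apply, h.symm (γ t), h1]
      simp
  refine ⟨η (γ' a) (γ' a), γ', fun t ht => ⟨(hp.2 t ht).1, hconst t ht, hd t ht, ?_⟩⟩
  obtain ⟨-, k, hk⟩ := hp.2 t ht
  -- Differentiating `η γ' γ = 0` yields `k * η γ γ + η γ' γ' = 0`, which determines `k`.
  have h1 := h.hasDerivWithinAt_apply hk (hd t ht)
  have h2 : HasDerivWithinAt (fun τ => η (γ' τ) (γ τ)) 0 (Icc a b) t :=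
    (hasDerivWithinAt_const t (Icc a b) (0 : ℝ)).congr (fun τ hτ => (hp.2 τ hτ).1) (hp.2 t ht).1
  have h3 := (uniqueDiffOn_Icc hab t ht).eq_deriv _ h1 h2
  rw [hconst t ht, map_smul, LinearMap.smul_apply, (hs.2 t ht).1] at h3
  have h4 : k = η (γ' a) (γ' a) := by
    simp only [smul_eq_mul] at h3
    linarith
  rwa [← h4]

/-- The curve `cosh (ρ (t - a)) s + sinh (ρ (t - a)) e`. -/
noncomputable def hyperbola (s e : V) (ρ a t : ℝ) : V :=
  Real.cosh (ρ * (t - a)) • s + Real.sinh (ρ * (t - a)) • e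

/-- Swapping `s` and `e` twice returns to the curve, so the acceleration is `ρ * ρ` times the
position, hence normal. -/
theorem hasDerivAt_hyperbola (s e : V) (ρ a t : ℝ) :
    HasDerivAt (hyperbola s e ρ a) (ρ • hyperbola e s ρ a t) t := by
  have h1 : HasDerivAt (fun t => ρ * (t - a)) ρ t := by
    simpa using ((hasDerivAt_id t).sub_const a).const_mul ρ
  refine ((h1.cosh.smul_const s).add (h1.sinh.smul_const e)).congr_deriv ?_
  simp only [hyperbola]
  module

theorem contDiff_hyperbola (s e : V) (ρ a : ℝ) : ContDiff ℝ ∞ (hyperbola s e ρ a) := by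
  unfold hyperbola
  fun_prop

theorem hyperbola_left (s e : V) (ρ a : ℝ) : hyperbola s e ρ a a = s := by
  simp [hyperbola]

theorem apply_hyperbola (v s e : V) (ρ a t : ℝ) :
    η v (hyperbola s e ρ a t) =
      Real.cosh (ρ * (t - a)) * η v s + Real.sinh (ρ * (t - a)) * η v e := by
  simp [hyperbola]

theorem hyperbola_apply (v s e : V) (ρ a t : ℝ) :
    η (hyperbola s e ρ a t) v =
      Real.cosh (ρ * (t - a)) * η s v + Real.sinh (ρ * (t - a)) * η e v := by
  simp [hyperbola]

theorem hyperbola_self (h : IsLorentzian η) {s e : V} (hs : η s s = -1) (he : η e e = 1)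
    (hes : η e s = 0) (ρ a t : ℝ) :
    η (hyperbola s e ρ a t) (hyperbola s e ρ a t) = -1 := by
  have hse : η s e = 0 := by rw [h.symm, hes]
  simp only [apply_hyperbola, hyperbola_apply, hs, he, hes, hse]
  nlinarith [Real.cosh_sq (ρ * (t - a))]

theorem hyperbola_swap (h : IsLorentzian η) {s e : V} (hs : η s s = -1) (he : η e e = 1)
    (hes : η e s = 0) (ρ a t : ℝ) :
    η (hyperbola e s ρ a t) (hyperbola s e ρ a t) = 0 := by
  have hse : η s e = 0 := by rw [h.symm, hes]
  simp only [apply_hyperbola, hyperbola_apply, hs, he, hes, hse]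
  ring

theorem isSmoothCurve_hyperbola (h : IsLorentzian η) (hs₀ : η s₀ s₀ = -1) {s e : V}
    (hs : s ∈ stateSpace η s₀) (he : η e e = 1) (hes : η e s = 0) (ρ a b : ℝ) :
    IsSmoothCurve η s₀ a b (hyperbola s e ρ a) := by
  refine ⟨(contDiff_hyperbola s e ρ a).contDiffOn, fun t _ => ?_⟩
  have hself := h.hyperbola_self hs.1 he hes ρ a t
  rw [h.mem_stateSpace_iff hs₀ hself]
  have h1 : η (hyperbola s e ρ a t) s < 0 := by
    rw [h.symm, apply_hyperbola, hs.1, h.symm, hes]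
    have := Real.cosh_pos (ρ * (t - a))
    linarith
  have h2 := h.timelike_mul_neg (u := hyperbola s e ρ a t) (v := s) (w := s₀)
    (by rw [hself]; norm_num) (by rw [hs.1]; norm_num) (by rw [hs₀]; norm_num)
  have h3 : 0 < η (hyperbola s e ρ a t) s * η s s₀ :=
    mul_pos_of_neg_of_neg h1 (by linarith [hs.2])
  by_contra hc
  have := mul_nonneg h3.le (not_lt.1 hc)
  linarith

theorem isGeodesic_hyperbola (h : IsLorentzian η) (hs₀ : η s₀ s₀ = -1) (hab : a < b) {s e : V}
    (hs : s ∈ stateSpace η s₀) (he : η e e = 1) (hes : η e s = 0) (ρ : ℝ) :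
    IsGeodesic η s₀ a b (hyperbola s e ρ a) := by
  have hsm := h.isSmoothCurve_hyperbola hs₀ hs he hes ρ a b
  have hd : ∀ t ∈ Icc a b, derivWithin (hyperbola s e ρ a) (Icc a b) t =
      ρ • hyperbola e s ρ a t := fun t ht =>
    (hasDerivAt_hyperbola s e ρ a t).hasDerivWithinAt.derivWithin (uniqueDiffOn_Icc hab t ht)
  refine ⟨hsm, (h.isParallelAlong_iff hs₀ hab hsm).2 ⟨?_, fun t ht => ⟨?_, ρ * ρ, ?_⟩⟩⟩
  · exact ((contDiff_hyperbola e s ρ a).const_smul ρ).contDiffOn.congr hd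
  · rw [hd t ht, map_smul, LinearMap.smul_apply, h.hyperbola_swap hs.1 he hes, smul_zero]
  · refine HasDerivWithinAt.congr ?_ hd (hd t ht)
    rw [mul_smul]
    exact ((hasDerivAt_hyperbola e s ρ a t).const_smul ρ).hasDerivWithinAt

theorem exists_geodesic (h : IsLorentzian η) (hs₀ : η s₀ s₀ = -1) (hab : a < b) {s₁ s₂ : V}
    (hs₁ : s₁ ∈ stateSpace η s₀) (hs₂ : s₂ ∈ stateSpace η s₀) (hne : s₁ ≠ s₂) :
    ∃ γ : ℝ → V, IsGeodesic η s₀ a b γ ∧ γ a = s₁ ∧ γ b = s₂ := by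
  have h12 := h.inner_lt_neg_one hs₀ hs₁ hs₂ hne
  -- `θ` is the hyperbolic distance from `s₁` to `s₂`; `e` below is the unit tangent at `s₁`
  -- pointing towards `s₂`, and the speed is `θ / (b - a)`.
  set θ := Real.arcosh (-η s₁ s₂) with hθ
  have hcosh : Real.cosh θ = -η s₁ s₂ := Real.cosh_arcosh (by linarith)
  have hpos : 0 < θ := Real.arcosh_pos (by linarith)
  have hsinh := (Real.sinh_pos_iff.2 hpos).ne'
  set e := (Real.sinh θ)⁻¹ • (s₂ - Real.cosh θ • s₁) with he
  have hes : η e s₁ = 0 := by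
    simp [he, hs₁.1, h.symm s₂ s₁, hcosh]
  have hee : η e e = 1 := by
    have hsq : Real.sinh θ ^ 2 = η s₁ s₂ ^ 2 - 1 := by
      rw [Real.sinh_sq, hcosh]
      ring
    simp only [he, map_smul, map_sub, LinearMap.smul_apply, LinearMap.sub_apply, smul_eq_mul,
      hs₁.1, hs₂.1, h.symm s₂ s₁, hcosh]
    field_simp
    rw [hsq]
    ring
  refine ⟨hyperbola s₁ e (θ / (b - a)) a, h.isGeodesic_hyperbola hs₀ hab hs₁ hee hes _,
    hyperbola_left _ _ _ _, ?_⟩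
  have hba : b - a ≠ 0 := (sub_pos.2 hab).ne'
  rw [hyperbola, div_mul_cancel₀ _ hba, he, smul_inv_smul₀ hsinh]
  abel

/-- A geodesic with distinct end points is an arc of a hyperbola. -/
theorem geodesic_eq_hyperbola (h : IsLorentzian η) (hs₀ : η s₀ s₀ = -1) (hab : a < b) {γ : ℝ → V}
    (hγ : IsGeodesic η s₀ a b γ) (hne : γ a ≠ γ b) :
    ∃ (ρ : ℝ) (e : V), 0 < ρ ∧ η e e = 1 ∧ η e (γ a) = 0 ∧
      ∀ t ∈ Icc a b, γ t = hyperbola (γ a) e ρ a t := by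
  obtain ⟨κ, γ', H⟩ := h.geodesic_equation hs₀ hab hγ
  have ha : a ∈ Icc a b := left_mem_Icc.2 hab.le
  have hb : b ∈ Icc a b := right_mem_Icc.2 hab.le
  have hneg : ∀ t ∈ Icc a b, η (γ t) (γ t) < 0 := fun t ht => by
    rw [(hγ.1.2 t ht).1]
    norm_num
  have hκ : 0 < κ := by
    refine lt_of_le_of_ne ?_ fun h0 => hne ?_
    · rw [← (H a ha).2.1]
      exact h.nonneg_of_orthogonal (hneg a ha) (H a ha).1
    · refine (eq_left_of_hasDerivWithinAt_zero hab (fun t ht => ?_) b hb).symm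
      rw [← h.eq_zero_of_orthogonal (hneg t ht) (H t ht).1 ((H t ht).2.1.trans h0.symm)]
      exact (H t ht).2.2.1
  set ρ := √κ with hρ
  have hρpos : 0 < ρ := Real.sqrt_pos.2 hκ
  have hρκ : κ = ρ * ρ := (Real.mul_self_sqrt hκ.le).symm
  have h1 : ∀ t : ℝ, HasDerivWithinAt (fun t => ρ * (t - a)) ρ (Icc a b) t := fun t => by
    simpa using (((hasDerivAt_id t).sub_const a).const_mul ρ).hasDerivWithinAt
  -- `F` and `G` undo the hyperbolic rotation of `(γ, γ')`, so they are first integrals, with values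
  -- `ρ • γ a` and `γ' a`.
  have hF := eq_left_of_hasDerivWithinAt_zero hab
    (f := fun t => (ρ * Real.cosh (ρ * (t - a))) • γ t - Real.sinh (ρ * (t - a)) • γ' t)
    fun t ht => by
      refine ((((h1 t).cosh.const_mul ρ).smul (H t ht).2.2.1).sub
        ((h1 t).sinh.smul (H t ht).2.2.2)).congr_deriv ?_
      rw [hρκ]
      module
  have hG := eq_left_of_hasDerivWithinAt_zero hab
    (f := fun t => Real.cosh (ρ * (t - a)) • γ' t - (ρ * Real.sinh (ρ * (t - a))) • γ t)
    fun t ht => by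
      refine (((h1 t).cosh.smul (H t ht).2.2.2).sub
        (((h1 t).sinh.const_mul ρ).smul (H t ht).2.2.1)).congr_deriv ?_
      rw [hρκ]
      module
  refine ⟨ρ, ρ⁻¹ • γ' a, hρpos, ?_, ?_, fun t ht => ?_⟩
  · simp only [map_smul, LinearMap.smul_apply, (H a ha).2.1, smul_eq_mul]
    rw [hρκ]
    field_simp
  · simp [(H a ha).1]
  · have hFt := hF t ht
    have hGt := hG t ht
    simp only [sub_self, mul_zero, Real.cosh_zero, Real.sinh_zero, zero_smul, sub_zero, mul_one,
      one_smul] at hFt hGt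
    have hsq := Real.cosh_sq (ρ * (t - a))
    set c := Real.cosh (ρ * (t - a))
    set d := Real.sinh (ρ * (t - a))
    have hγa : γ a = c • γ t - (ρ⁻¹ * d) • γ' t := by
      rw [← inv_smul_smul₀ hρpos.ne' (γ a), ← hFt, smul_sub, smul_smul, smul_smul,
        inv_mul_cancel_left₀ hρpos.ne']
    rw [hyperbola]
    change γ t = c • γ a + d • ρ⁻¹ • γ' a
    rw [← hGt, hγa]
    have : γ t = (c ^ 2 - d ^ 2) • γ t := by rw [hsq]; simp
    conv_lhs => rw [this]
    match_scalars
    · field_simp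
      ring
    · ring

/-- Pairing with `s` isolates `cosh`, injective on nonnegative arguments; then the nonzero `sinh`
cancels. Positivity is needed because `(-ρ, -e)` traces the same curve as `(ρ, e)`. -/
theorem hyperbola_unique (h : IsLorentzian η) (hab : a < b) {s e e' : V} {ρ ρ' : ℝ}
    (hs : η s s = -1) (hes : η e s = 0) (hes' : η e' s = 0) (hρ : 0 < ρ) (hρ' : 0 < ρ')
    (hb : hyperbola s e ρ a b = hyperbola s e' ρ' a b) : ρ = ρ' ∧ e = e' := by
  have hba : 0 < b - a := sub_pos.2 hab
  have hc := congrArg (η s) hb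
  rw [apply_hyperbola, apply_hyperbola, h.symm s e, h.symm s e', hs, hes, hes'] at hc
  have hc' : Real.cosh (ρ * (b - a)) = Real.cosh (ρ' * (b - a)) := by linarith
  have hρρ := mul_right_cancel₀ hba.ne'
    (Real.cosh_strictMonoOn.injOn (mul_pos hρ hba).le (mul_pos hρ' hba).le hc')
  subst hρρ
  refine ⟨rfl, ?_⟩
  have := add_left_cancel hb
  exact smul_right_injective V (Real.sinh_pos_iff.2 (mul_pos hρ hba)).ne' this

/-- Parallel transport of `y` along a hyperbola. -/
noncomputable def hyperbolaTransport (η : LinearMap.BilinForm ℝ V) (s e y : V) (ρ a t : ℝ) : V :=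
  y + η y e • (hyperbola e s ρ a t - e)

theorem isParallelAlong_hyperbolaTransport (h : IsLorentzian η) (hs₀ : η s₀ s₀ = -1)
    (hab : a < b) {γ : ℝ → V} (hγ : IsSmoothCurve η s₀ a b γ) {s e y : V} {ρ : ℝ}
    (hs : η s s = -1) (he : η e e = 1) (hes : η e s = 0) (hy : η y s = 0)
    (heq : ∀ t ∈ Icc a b, γ t = hyperbola s e ρ a t) :
    IsParallelAlong η s₀ a b γ (hyperbolaTransport η s e y ρ a) := by
  refine (h.isParallelAlong_iff hs₀ hab hγ).2 ⟨?_, fun t ht => ⟨?_, η y e * ρ, ?_⟩⟩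
  · exact (contDiff_const.add
      (((contDiff_hyperbola e s ρ a).sub contDiff_const).const_smul _)).contDiffOn
  · rw [heq t ht, hyperbolaTransport, LinearMap.map_add₂, LinearMap.map_smul₂,
      LinearMap.map_sub₂, h.hyperbola_swap hs he hes, apply_hyperbola, apply_hyperbola, hy, hes, he]
    simp only [smul_eq_mul]
    ring
  · rw [heq t ht, mul_smul]
    exact (((hasDerivAt_hyperbola e s ρ a t).sub_const e).const_smul (η y e)).const_add y
      |>.hasDerivWithinAt

theorem hyperbolaTransport_right (h : IsLorentzian η) {s e y : V} {ρ : ℝ}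
    (hs : η s s = -1) (he : η e e = 1) (hes : η e s = 0) (hy : η y s = 0) :
    hyperbolaTransport η s e y ρ a b = boost η s (hyperbola s e ρ a b) y := by
  have hself := h.hyperbola_self hs he hes ρ a b
  have hcpos := Real.cosh_pos (ρ * (b - a))
  have hsc : η s (hyperbola s e ρ a b) = -Real.cosh (ρ * (b - a)) := by
    rw [apply_hyperbola, hs, h.symm s e, hes]
    ring
  rw [h.boost_apply_tangent hs hself (by rw [hsc]; linarith) hy, hsc, apply_hyperbola, hy,
    hyperbolaTransport, hyperbola, hyperbola]
  have hsq := Real.cosh_sq (ρ * (b - a))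
  set c := Real.cosh (ρ * (b - a))
  set d := Real.sinh (ρ * (b - a))
  have hc : -c - 1 ≠ 0 := by linarith
  -- This identity matches the coefficients of `e`: `c - 1` from the transport and `d * d / (c + 1)`
  -- from the boost.
  have hd : d * d = (c - 1) * (c + 1) := by linarith
  match_scalars
  · ring
  · field_simp
    linear_combination η y e * hd
  · field_simp
    ring

end Geodesics

end IsLorentzian

theorem mainTheorem7 {V : Type*} [NormedAddCommGroup V] [NormedSpace ℝ V]
    (η : LinearMap.BilinForm ℝ V) (hη : IsLorentzian η)
    (s₀ : V) (hs₀ : η s₀ s₀ = -1)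
    (s₁ s₂ : V) (hs₁ : s₁ ∈ stateSpace η s₀) (hs₂ : s₂ ∈ stateSpace η s₀) (hne : s₁ ≠ s₂)
    (σ₁ σ₂ : ℝ) (hσ : σ₁ < σ₂) :
    -- there is a unique boost in the plane `Span {s₁, s₂}` mapping `s₁` to `s₂`
    (∃! B : V →ₗ[ℝ] V, IsBoostInPlane η (Submodule.span ℝ {s₁, s₂}) B ∧ B s₁ = s₂) ∧
    -- there is a geodesic `[σ₁, σ₂] → 𝒮` from `s₁` to `s₂`
    (∃ γ : ℝ → V, IsGeodesic η s₀ σ₁ σ₂ γ ∧ γ σ₁ = s₁ ∧ γ σ₂ = s₂) ∧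
    -- which is unique
    (∀ γ γ' : ℝ → V, IsGeodesic η s₀ σ₁ σ₂ γ → γ σ₁ = s₁ → γ σ₂ = s₂ →
      IsGeodesic η s₀ σ₁ σ₂ γ' → γ' σ₁ = s₁ → γ' σ₂ = s₂ →
      Set.EqOn γ γ' (Set.Icc σ₁ σ₂)) ∧
    -- and parallel transport along it is the action of the boost
    (∀ B : V →ₗ[ℝ] V, IsBoostInPlane η (Submodule.span ℝ {s₁, s₂}) B → B s₁ = s₂ →
      ∀ γ : ℝ → V, IsGeodesic η s₀ σ₁ σ₂ γ → γ σ₁ = s₁ → γ σ₂ = s₂ →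
      ∀ Y₁ ∈ stateTangent η s₁, B Y₁ ∈ stateTangent η s₂ ∧
        ∀ Y₂ : V, IsParallelTransport η s₀ σ₁ σ₂ γ Y₁ Y₂ ↔ Y₂ = B Y₁) := by
  have h12 := hη.inner_lt_neg_one hs₀ hs₁ hs₂ hne
  have h12' : η s₁ s₂ < 0 := by linarith
  have hboost := fun B (hB : IsBoostInPlane η (Submodule.span ℝ {s₁, s₂}) B) (hB12 : B s₁ = s₂) =>
    hη.eq_boost hs₁.1 hs₂.1 h12 hB hB12
  have hright : σ₂ ∈ Icc σ₁ σ₂ := right_mem_Icc.2 hσ.le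
  have hhyp : ∀ γ : ℝ → V, IsGeodesic η s₀ σ₁ σ₂ γ → γ σ₁ = s₁ → γ σ₂ = s₂ →
      ∃ (ρ : ℝ) (e : V), 0 < ρ ∧ η e e = 1 ∧ η e s₁ = 0 ∧
        ∀ t ∈ Icc σ₁ σ₂, γ t = IsLorentzian.hyperbola s₁ e ρ σ₁ t := by
    intro γ hγ h1 h2
    have := hη.geodesic_eq_hyperbola hs₀ hσ hγ (by rwa [h1, h2])
    rwa [h1] at this
  refine ⟨⟨IsLorentzian.boost η s₁ s₂, ⟨hη.isBoostInPlane_boost hs₁.1 hs₂.1 h12',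
    hη.boost_left hs₁.1 hs₂.1 h12'⟩, fun B hB => hboost B hB.1 hB.2⟩,
    hη.exists_geodesic hs₀ hσ hs₁ hs₂ hne, ?_, ?_⟩
  · intro γ γ' hγ h1 h2 hγ' h1' h2'
    obtain ⟨ρ, e, hρ, -, he, heq⟩ := hhyp γ hγ h1 h2
    obtain ⟨ρ', e', hρ', -, he', heq'⟩ := hhyp γ' hγ' h1' h2'
    obtain ⟨rfl, rfl⟩ := hη.hyperbola_unique hσ hs₁.1 he he' hρ hρ'
      (by rw [← heq σ₂ hright, ← heq' σ₂ hright, h2, h2'])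
    exact fun t ht => (heq t ht).trans (heq' t ht).symm
  · intro B hB hB12 γ hγ h1 h2 Y₁ hY₁
    refine ⟨?_, ?_⟩
    · change η (B Y₁) s₂ = 0
      rw [← hB12, hB.1.1]
      exact hY₁
    · obtain ⟨ρ, e, hρ, hee, he, heq⟩ := hhyp γ hγ h1 h2
      have hpar := hη.isParallelAlong_hyperbolaTransport hs₀ hσ hγ.1 hs₁.1 hee he hY₁ heq
      have hleft : IsLorentzian.hyperbolaTransport η s₁ e Y₁ ρ σ₁ σ₁ = Y₁ := by
        simp [IsLorentzian.hyperbolaTransport, IsLorentzian.hyperbola_left]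
      have hend : IsLorentzian.hyperbolaTransport η s₁ e Y₁ ρ σ₁ σ₂ = B Y₁ := by
        rw [hη.hyperbolaTransport_right hs₁.1 hee he hY₁, ← heq σ₂ hright, h2, hboost B hB hB12]
      refine fun Y₂ => ⟨?_, ?_⟩
      · rintro ⟨Y, hY, hYa, hYb⟩
        rw [← hYb, ← hend]
        -- Any parallel field starting at `Y₁` agrees with the explicit one, so the transported
        -- vector is independent of the field chosen.
        exact hη.parallel_unique hs₀ hσ hγ.1 hY hpar (hYa.trans hleft.symm) σ₂ hright
      · rintro rfl
        exact ⟨_, hpar, hleft, hend⟩
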